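/- Let $X$ be a set with at least two elements (possibly infinite) and let $r\colon X\times X\to X\times X$, $r(x,y)=(\sigma_x(y),\tau_y(x))$, be an involutive non-degenerate solution of the Yang–Baxter equation, i.e. $r^2=\mathrm{id}$, all maps $\sigma_x,\tau_x\colon X\to X$ are bijective, and $(r\times\mathrm{id})(\mathrm{id}\times r)(r\times\mathrm{id})=(\mathrm{id}\times r)(r\times\mathrm{id})(\mathrm{id}\times r)$. A left brace is a set $A$ with an abelian group structure $(A,+)$ and a group structure $(A,\circ)$ such that $a\circ(b+c)=a\circ b-a+a\circ c$ for all $a,b,c\in A$; put $\lambda_a(b)=-a+a\circ b$. A left ideal of $A$ is a subgroup $I$ of $(A,+)$ with $\lambda_a(I)\subseteq I$ for all $a\in A$; it is trivial as a left brace if $a+b=a\circ b$ for all $a,b\in I$. The socle is the ideal $\mathrm{Soc}(A)=\{a\in A:\lambda_a=\mathrm{id}\}$. Let $G(X,r)$ be the group generated by $X$ with relations $x\circ y=u\circ v$ whenever $r(x,y)=(u,v)$, with its canonical left brace structure, in which $(G(X,r),\circ)$ is this group, the additive group is free abelian on $X$, and $\lambda_x(y)=\sigma_x(y)$ for $x,y\in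 X$; and let $\mathcal G(X,r)=G(X,r)/\mathrm{Soc}(G(X,r))$ be the quotient left brace. The retraction $\mathrm{Ret}(X,r)$ is the solution induced by $r$ on the set of classes of the equivalence relation $x\sim y\iff\sigma_x=\sigma_y$; put $\mathrm{Ret}^0(X,r)=(X,r)$ and $\mathrm{Ret}^{n}(X,r)=\mathrm{Ret}(\mathrm{Ret}^{n-1}(X,r))$ for $n\ge 1$. The solution $(X,r)$ is multipermutation of level $m$ if $\mathrm{Ret}^m(X,r)$ has exactly one element and $\mathrm{Ret}^{m-1}(X,r)$ has more than one element. If there are left ideals $B$ and $C$ of $\mathcal G(X,r)$, both trivial as left braces, such that $\mathcal G(X,r)=B+C$, then $(X,r)$ is a multipermutation solution of level $m$ for some $m\le 3$. -/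

import Mathlib

universe u

/-! ### Left braces -/

/-- A left brace: an abelian group `(A, +)` and a group `(A, ∘)` on the same set (the operation `∘` is
written `*`) such that `a ∘ (b + c) = a ∘ b - a + a ∘ c`. -/
class LeftBrace (A : Type u) extends AddCommGroup A, Group A where
  mul_add_brace : ∀ a b c : A, a * (b + c) = a * b - a + a * c

namespace LeftBrace

variable {A : Type u} [LeftBrace A]

/-- `λ_a(b) = -a + a ∘ b`. -/
def lam (a b : A) : A := -a + a * b

theorem mul_eq (a b : A) : a * b = a + lam a b := by simp [lam]

theorem lam_add (a b c : A) : lam a (b + c) = lam a b + lam a c := by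
  simp only [lam, mul_add_brace]; abel

theorem one_eq_zero : (1 : A) = 0 := by
  have h := mul_add_brace (1 : A) 0 0
  simpa using h

theorem lam_zero (a : A) : lam a 0 = 0 := by
  simpa using lam_add a 0 0

theorem lam_neg (a b : A) : lam a (-b) = -lam a b := by
  have h := lam_add a b (-b)
  rw [add_neg_cancel, lam_zero] at h
  exact (neg_eq_of_add_eq_zero_right h.symm).symm

theorem lam_mul (a b c : A) : lam (a * b) c = lam a (lam b c) := by
  have h : a * (b * c) = a + (lam a b + lam a (lam b c)) := by
    rw [mul_eq a, mul_eq b, lam_add]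
  have h2 : a * b = a + lam a b := mul_eq a b
  unfold lam at h h2 ⊢
  rw [mul_assoc, h]
  abel

theorem lam_one (b : A) : lam 1 b = b := by simp [lam, one_eq_zero]

/-- A left ideal: a subgroup of `(A, +)` that every `λ_a` maps into itself. -/
def IsLeftIdeal (I : AddSubgroup A) : Prop := ∀ a : A, ∀ b ∈ I, lam a b ∈ I

/-- An ideal: a left ideal that is normal in `(A, ∘)` (normality in `(A, +)` is automatic here). -/
structure IsIdeal (I : AddSubgroup A) : Prop where
  isLeftIdeal : IsLeftIdeal I
  conj_mem : ∀ a : A, ∀ b ∈ I, a * b * a⁻¹ ∈ I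

/-- A left ideal (hence a left subbrace) is trivial as a left brace if `+` and `∘` agree on it. -/
def IsTrivialOn (I : AddSubgroup A) : Prop := ∀ a ∈ I, ∀ b ∈ I, a + b = a * b

/-- `A` admits a factorization through the left ideals `B` and `C` if `A = B + C`. -/
structure IsFactorization (B C : AddSubgroup A) : Prop where
  left_isLeftIdeal : IsLeftIdeal B
  right_isLeftIdeal : IsLeftIdeal C
  exists_add : ∀ a : A, ∃ b ∈ B, ∃ c ∈ C, a = b + c

variable (A) in
/-- The socle of a left brace: the kernel of `λ` (the centre of `(A, +)` being all of `A`). -/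
def socle : AddSubgroup A where
  carrier := {a | ∀ b : A, lam a b = b}
  zero_mem' := fun b => by rw [← one_eq_zero, lam_one]
  add_mem' := by
    intro a b ha hb c
    have h : a + b = a * b := by rw [mul_eq, ha]
    rw [h, lam_mul, hb, ha]
  neg_mem' := by
    intro a ha c
    have h : -a = a⁻¹ := by
      have h1 := mul_eq a a⁻¹
      rw [ha, mul_inv_cancel, one_eq_zero] at h1
      exact neg_eq_of_add_eq_zero_right h1.symm
    have h2 := lam_mul a⁻¹ a c
    rw [inv_mul_cancel, lam_one, ha] at h2
    rw [h, ← h2]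

theorem mem_socle {a : A} : a ∈ socle A ↔ ∀ b : A, lam a b = b := Iff.rfl

theorem socle_isIdeal : IsIdeal (socle A) := by
  have key : ∀ a : A, ∀ b ∈ socle A, a * b * a⁻¹ ∈ socle A := by
    intro a b hb c
    rw [lam_mul, lam_mul, hb, ← lam_mul, mul_inv_cancel, lam_one]
  refine ⟨fun a b hb => ?_, key⟩
  have h : lam a b = a * b * a⁻¹ := by
    rw [mul_assoc, mul_eq a, mul_eq b, hb, lam_add, add_comm (lam a b), ← add_assoc, ← mul_eq,
      mul_inv_cancel, one_eq_zero, zero_add]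
  rw [h]
  exact key a b hb

section Quotient

variable {I : AddSubgroup A}

/-- Additive and multiplicative left cosets of an ideal agree. -/
theorem IsIdeal.sub_mem_iff (hI : IsIdeal I) (a b : A) : -a + b ∈ I ↔ a⁻¹ * b ∈ I := by
  have e : -a + b = lam a (a⁻¹ * b) := by simp [lam]
  constructor
  · intro h
    have := hI.isLeftIdeal a⁻¹ _ h
    rwa [e, ← lam_mul, inv_mul_cancel, lam_one] at this
  · intro h
    rw [e]
    exact hI.isLeftIdeal a _ h

theorem IsIdeal.mul_compat (hI : IsIdeal I) (a a' b b' : A) (ha : a⁻¹ * a' ∈ I) (hb : b⁻¹ * b' ∈ I) :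
    (a * b)⁻¹ * (a' * b') ∈ I := by
  have h1 : (a * b)⁻¹ * (a' * b') = (b⁻¹ * (a⁻¹ * a') * b⁻¹⁻¹) * (b⁻¹ * b') := by group
  rw [h1, mul_eq]
  exact I.add_mem (hI.conj_mem _ _ ha) (hI.isLeftIdeal _ _ hb)

theorem IsIdeal.inv_compat (hI : IsIdeal I) (a a' : A) (ha : a⁻¹ * a' ∈ I) : a⁻¹⁻¹ * a'⁻¹ ∈ I := by
  have h0 : ∀ c ∈ I, c⁻¹ ∈ I := by
    intro c hc
    have h1 : c⁻¹ = -lam c⁻¹ c := by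
      have := mul_eq c⁻¹ c
      rw [inv_mul_cancel, one_eq_zero] at this
      exact eq_neg_of_add_eq_zero_left this.symm
    rw [h1]
    exact I.neg_mem (hI.isLeftIdeal _ _ hc)
  have h1 : a⁻¹⁻¹ * a'⁻¹ = a * (a⁻¹ * a')⁻¹ * a⁻¹ := by group
  rw [h1]
  exact hI.conj_mem _ _ (h0 _ ha)

/-- The carrier of the quotient brace `A / I`: the cosets of the ideal `I`. -/
def QuotientBrace (I : AddSubgroup A) (_hI : IsIdeal I) : Type u := A ⧸ I

variable (hI : IsIdeal I)

instance : AddCommGroup (QuotientBrace I hI) := inferInstanceAs (AddCommGroup (A ⧸ I))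

/-- The canonical projection `A → A / I`. -/
def QuotientBrace.mk (a : A) : QuotientBrace I hI := (QuotientAddGroup.mk a : A ⧸ I)

theorem QuotientBrace.mk_eq {a b : A} : QuotientBrace.mk hI a = QuotientBrace.mk hI b ↔ a⁻¹ * b ∈ I := by
  rw [← hI.sub_mem_iff]
  exact QuotientAddGroup.eq

theorem QuotientBrace.mk_surjective : Function.Surjective (QuotientBrace.mk hI) := QuotientAddGroup.mk_surjective

/-- The multiplicative group of `A / I`. -/
instance : Group (QuotientBrace I hI) where
  mul := Quotient.map₂ (· * ·) (by
    intro a a' ha b b' hb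
    refine QuotientAddGroup.leftRel_apply.2 ((hI.sub_mem_iff _ _).2 (hI.mul_compat _ _ _ _ ?_ ?_))
    · exact (hI.sub_mem_iff _ _).1 (QuotientAddGroup.leftRel_apply.1 ha)
    · exact (hI.sub_mem_iff _ _).1 (QuotientAddGroup.leftRel_apply.1 hb))
  one := QuotientBrace.mk hI 1
  inv := Quotient.map (·⁻¹) (by
    intro a a' ha
    exact QuotientAddGroup.leftRel_apply.2 ((hI.sub_mem_iff _ _).2 (hI.inv_compat _ _
      ((hI.sub_mem_iff _ _).1 (QuotientAddGroup.leftRel_apply.1 ha)))))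
  mul_assoc := by
    rintro ⟨a⟩ ⟨b⟩ ⟨c⟩
    exact congrArg (QuotientBrace.mk hI) (mul_assoc a b c)
  one_mul := by
    rintro ⟨a⟩
    exact congrArg (QuotientBrace.mk hI) (one_mul a)
  mul_one := by
    rintro ⟨a⟩
    exact congrArg (QuotientBrace.mk hI) (mul_one a)
  inv_mul_cancel := by
    rintro ⟨a⟩
    exact congrArg (QuotientBrace.mk hI) (inv_mul_cancel a)

theorem QuotientBrace.mk_mul (a b : A) : QuotientBrace.mk hI (a * b) = QuotientBrace.mk hI a * QuotientBrace.mk hI b := rfl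

theorem QuotientBrace.mk_add (a b : A) : QuotientBrace.mk hI (a + b) = QuotientBrace.mk hI a + QuotientBrace.mk hI b := rfl

/-- The quotient brace `A / I`, with both operations induced from `A`. -/
instance : LeftBrace (QuotientBrace I hI) where
  mul_add_brace := by
    rintro ⟨a⟩ ⟨b⟩ ⟨c⟩
    exact congrArg (QuotientBrace.mk hI) (mul_add_brace a b c)

end Quotient

end LeftBrace

/-! ### Involutive non-degenerate solutions of the Yang-Baxter equation -/

namespace YB

/-- `r × id` on `X × X × X`. -/
def r12 {X : Type u} (r : X × X → X × X) (p : X × X × X) : X × X × X :=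
  ((r (p.1, p.2.1)).1, (r (p.1, p.2.1)).2, p.2.2)

/-- `id × r` on `X × X × X`. -/
def r23 {X : Type u} (r : X × X → X × X) (p : X × X × X) : X × X × X := (p.1, r p.2)

/-- An involutive non-degenerate set-theoretic solution of the Yang-Baxter equation on `X`, where
`r (x, y) = (σ_x y, τ_y x)`. Bijectivity of `r` follows from `r ∘ r = id`. -/
structure Solution (X : Type u) where
  r : X × X → X × X
  yang_baxter : r12 r ∘ r23 r ∘ r12 r = r23 r ∘ r12 r ∘ r23 r
  bijective_left : ∀ x, Function.Bijective fun y => (r (x, y)).1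
  bijective_right : ∀ y, Function.Bijective fun x => (r (x, y)).2
  involutive : Function.Involutive r

namespace Solution

variable {X : Type u} (S : Solution X)

/-- `σ_x`. -/
noncomputable def sig (x : X) : Equiv.Perm X := Equiv.ofBijective _ (S.bijective_left x)

/-- `τ_y`. -/
noncomputable def tau (y : X) : Equiv.Perm X := Equiv.ofBijective _ (S.bijective_right y)

theorem r_eq (x y : X) : S.r (x, y) = (S.sig x y, S.tau y x) := rfl

theorem sig_sig_tau (x y : X) : S.sig (S.sig x y) (S.tau y x) = x :=
  congrArg Prod.fst (S.involutive (x, y))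

theorem tau_tau_sig (x y : X) : S.tau (S.tau y x) (S.sig x y) = y :=
  congrArg Prod.snd (S.involutive (x, y))

theorem sig_mul (x y : X) : S.sig x * S.sig y = S.sig (S.sig x y) * S.sig (S.tau y x) := by
  ext z
  exact (congrArg Prod.fst (congrFun S.yang_baxter (x, y, z))).symm

/-- The solution with the two coordinates exchanged. -/
def op : Solution X where
  r := fun p => (S.r p.swap).swap
  yang_baxter := by
    funext p
    obtain ⟨x, y, z⟩ := p
    have h := congrFun S.yang_baxter (z, y, x)
    have h1 := congrArg Prod.fst h
    have h2 := congrArg (fun q => q.2.1) h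
    have h3 := congrArg (fun q => q.2.2) h
    exact Prod.ext h3.symm (Prod.ext h2.symm h1.symm)
  bijective_left := S.bijective_right
  bijective_right := S.bijective_left
  involutive := fun p => by simp [S.involutive _]

/-- The diagonal map `T(x) = σ_x⁻¹(x)`. -/
noncomputable def diag (x : X) : X := (S.sig x)⁻¹ x

theorem sig_diag (x : X) : S.sig x (S.diag x) = x := by simp [diag]

theorem tau_diag (x : X) : S.tau (S.diag x) x = S.diag x := by
  have h := S.sig_sig_tau x (S.diag x)
  rw [sig_diag] at h
  exact (S.sig x).injective (h.trans (S.sig_diag x).symm)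

theorem op_diag_diag (x : X) : S.op.diag (S.diag x) = x := by
  apply (S.tau (S.diag x)).injective
  rw [tau_diag]
  exact S.op.sig_diag (S.diag x)

theorem diag_op_diag (x : X) : S.diag (S.op.diag x) = x := S.op.op_diag_diag x

theorem diag_tau (x y : X) : S.diag (S.tau y x) = (S.sig y)⁻¹ (S.diag x) := by
  have h := S.sig_mul x y
  have h2 : S.tau y x = (S.sig (S.sig x y))⁻¹ x := by
    rw [Equiv.Perm.eq_inv_iff_eq]; exact S.sig_sig_tau x y
  have h3 : (S.sig (S.tau y x))⁻¹ = (S.sig y)⁻¹ * (S.sig x)⁻¹ * S.sig (S.sig x y) := by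
    rw [← mul_inv_rev, h]; group
  unfold diag
  rw [h3]
  simp only [Equiv.Perm.mul_apply, sig_sig_tau]

theorem tau_eq_of_sig_eq {y y' : X} (h : S.sig y = S.sig y') : S.tau y = S.tau y' := by
  ext x
  have : S.diag (S.tau y x) = S.diag (S.tau y' x) := by rw [diag_tau, diag_tau, h]
  rw [← S.op_diag_diag (S.tau y x), this, op_diag_diag]

theorem sig_eq_iff_tau_eq {y y' : X} : S.sig y = S.sig y' ↔ S.tau y = S.tau y' :=
  ⟨S.tau_eq_of_sig_eq, S.op.tau_eq_of_sig_eq⟩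

/-! ### The retraction -/

/-- `x ∼ y` if and only if `σ_x = σ_y`. -/
noncomputable def retSetoid : Setoid X := Setoid.comap S.sig ⊥

theorem sig_tau_congr (y : X) {x x' : X} (h : S.sig x = S.sig x') :
    S.sig (S.tau y x) = S.sig (S.tau y x') := by
  have h1 := S.sig_mul x y
  have h2 := S.sig_mul x' y
  rw [← h, h1] at h2
  exact mul_left_cancel h2

theorem sig_sig_congr (y : X) {x x' : X} (h : S.sig x = S.sig x') :
    S.sig (S.sig y x) = S.sig (S.sig y x') :=
  S.sig_eq_iff_tau_eq.2 (S.op.sig_tau_congr y (S.sig_eq_iff_tau_eq.1 h))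

theorem sig_sig_cancel (y : X) {x x' : X} (h : S.sig (S.sig y x) = S.sig (S.sig y x')) :
    S.sig x = S.sig x' := by
  have key : ∀ x, S.sig y * S.sig x = S.sig (S.sig y x) * S.sig ((S.sig (S.sig y x))⁻¹ y) := by
    intro x
    rw [S.sig_mul y x]
    congr 2
    rw [Equiv.Perm.eq_inv_iff_eq]
    exact S.sig_sig_tau y x
  have h1 := key x
  rw [h, ← key x'] at h1
  exact mul_left_cancel h1

theorem sig_tau_cancel (y : X) {x x' : X} (h : S.sig (S.tau y x) = S.sig (S.tau y x')) :
    S.sig x = S.sig x' :=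
  S.sig_eq_iff_tau_eq.2 (S.op.sig_sig_cancel y (S.sig_eq_iff_tau_eq.1 h))

/-- The underlying set of the retraction. -/
def RetType : Type u := Quotient S.retSetoid

/-- The class of an element in the retraction. -/
noncomputable def toRet (x : X) : S.RetType := Quotient.mk S.retSetoid x

theorem toRet_eq {x y : X} : S.toRet x = S.toRet y ↔ S.sig x = S.sig y := Quotient.eq

theorem toRet_surjective : Function.Surjective S.toRet := Quotient.mk_surjective

/-- The map induced by `r` on equivalence classes. -/
noncomputable def retMap (p : S.RetType × S.RetType) : S.RetType × S.RetType :=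
  Quotient.liftOn₂ p.1 p.2 (fun x y => (S.toRet (S.r (x, y)).1, S.toRet (S.r (x, y)).2)) (by
    intro x y x' y' (hx : S.sig x = S.sig x') (hy : S.sig y = S.sig y')
    refine Prod.ext (S.toRet_eq.2 ?_) (S.toRet_eq.2 ?_)
    · change S.sig (S.sig x y) = S.sig (S.sig x' y')
      rw [hx]
      exact S.sig_sig_congr x' hy
    · change S.sig (S.tau y x) = S.sig (S.tau y' x')
      rw [S.tau_eq_of_sig_eq hy]
      exact S.sig_tau_congr y' hx)

theorem retMap_mk (x y : X) :
    S.retMap (S.toRet x, S.toRet y) = (S.toRet (S.r (x, y)).1, S.toRet (S.r (x, y)).2) := rfl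

/-- The retraction `Ret(X, r)`. -/
noncomputable def ret : Solution S.RetType where
  r := S.retMap
  yang_baxter := by
    funext ⟨a, b, c⟩
    obtain ⟨x, rfl⟩ := S.toRet_surjective a
    obtain ⟨y, rfl⟩ := S.toRet_surjective b
    obtain ⟨z, rfl⟩ := S.toRet_surjective c
    exact congrArg (fun q : X × X × X => (S.toRet q.1, S.toRet q.2.1, S.toRet q.2.2))
      (congrFun S.yang_baxter (x, y, z))
  bijective_left := by
    intro a
    obtain ⟨x, rfl⟩ := S.toRet_surjective a
    constructor
    · intro b c h
      obtain ⟨y, rfl⟩ := S.toRet_surjective b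
      obtain ⟨z, rfl⟩ := S.toRet_surjective c
      exact S.toRet_eq.2 (S.sig_sig_cancel x (S.toRet_eq.1 h))
    · intro b
      obtain ⟨y, rfl⟩ := S.toRet_surjective b
      obtain ⟨z, rfl⟩ := (S.sig x).surjective y
      exact ⟨S.toRet z, rfl⟩
  bijective_right := by
    intro a
    obtain ⟨x, rfl⟩ := S.toRet_surjective a
    constructor
    · intro b c h
      obtain ⟨y, rfl⟩ := S.toRet_surjective b
      obtain ⟨z, rfl⟩ := S.toRet_surjective c
      exact S.toRet_eq.2 (S.sig_tau_cancel x (S.toRet_eq.1 h))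
    · intro b
      obtain ⟨y, rfl⟩ := S.toRet_surjective b
      obtain ⟨z, rfl⟩ := (S.tau x).surjective y
      exact ⟨S.toRet z, rfl⟩
  involutive := by
    rintro ⟨a, b⟩
    obtain ⟨x, rfl⟩ := S.toRet_surjective a
    obtain ⟨y, rfl⟩ := S.toRet_surjective b
    exact congrArg (fun q : X × X => (S.toRet q.1, S.toRet q.2)) (S.involutive (x, y))

/-- The iterated retraction `Ret^n(X, r)`, a set together with a solution on it. -/
noncomputable def iterRet : ℕ → Σ Y : Type u, Solution Y
  | 0 => ⟨X, S⟩
  | n + 1 => ⟨(iterRet n).2.RetType, (iterRet n).2.ret⟩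

/-- `(X, r)` is multipermutation of level `m`: `Ret^m(X, r)` has exactly one element, and
`Ret^(m-1)(X, r)` has more than one (the latter is void for `m = 0`). -/
def IsMultipermutation (m : ℕ) : Prop :=
  Nat.card (S.iterRet m).1 = 1 ∧ ∀ k, m = k + 1 → Nontrivial (S.iterRet k).1

/-! ### The structure group and its left brace structure -/

/-- The defining relators of the structure group: `x ∘ y = u ∘ v` whenever `r (x, y) = (u, v)`. -/
def rels : Set (FreeGroup X) :=
  {w | ∃ x y u v : X, S.r (x, y) = (u, v) ∧
    w = FreeGroup.of x * FreeGroup.of y * (FreeGroup.of u * FreeGroup.of v)⁻¹}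

/-- The structure group `G(X, r)`. -/
def StructureGroup : Type u := PresentedGroup S.rels

noncomputable instance : Group S.StructureGroup := inferInstanceAs (Group (PresentedGroup S.rels))

/-- The canonical map `X → G(X, r)`. -/
def of (x : X) : S.StructureGroup := PresentedGroup.of (rels := S.rels) x

theorem of_mul_of (x y : X) : S.of x * S.of y = S.of (S.sig x y) * S.of (S.tau y x) := by
  have h : (PresentedGroup.mk S.rels)
      (FreeGroup.of x * FreeGroup.of y *
        (FreeGroup.of (S.sig x y) * FreeGroup.of (S.tau y x))⁻¹) = 1 :=
    PresentedGroup.one_of_mem ⟨x, y, _, _, S.r_eq x y, rfl⟩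
  rw [map_mul, map_inv, mul_inv_eq_one, map_mul, map_mul] at h
  exact h

/-- Homomorphisms out of `G(X, r)`. -/
noncomputable def lift {H : Type u} [Group H] (f : X → H)
    (hf : ∀ x y, f x * f y = f (S.sig x y) * f (S.tau y x)) : S.StructureGroup →* H :=
  PresentedGroup.toGroup (rels := S.rels) (f := f) (by
    rintro w ⟨x, y, u, v, h, rfl⟩
    rw [r_eq, Prod.mk.injEq] at h
    obtain ⟨rfl, rfl⟩ := h
    simp [hf x y])

theorem lift_of {H : Type u} [Group H] (f : X → H)
    (hf : ∀ x y, f x * f y = f (S.sig x y) * f (S.tau y x)) (x : X) :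
    S.lift f hf (S.of x) = f x := PresentedGroup.toGroup.of _

theorem structureGroup_induction {p : S.StructureGroup → Prop} (one : p 1)
    (mul_of : ∀ g x, p g → p (g * S.of x)) (mul_inv : ∀ g x, p g → p (g * (S.of x)⁻¹))
    (g : S.StructureGroup) : p g := by
  have hg : g ∈ Subgroup.closure (Set.range S.of) := by
    have h : Subgroup.closure (Set.range S.of) = ⊤ := PresentedGroup.closure_range_of S.rels
    rw [h]; trivial
  induction hg using Subgroup.closure_induction_right with
  | one => exact one
  | mul_right g _ y hy ih => obtain ⟨x, rfl⟩ := hy; exact mul_of g x ih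
  | mul_inv_cancel g _ y hy ih => obtain ⟨x, rfl⟩ := hy; exact mul_inv g x ih

/-- The action of `G(X, r)` on `X` in which `x` acts as `σ_x`. -/
noncomputable def perm : S.StructureGroup →* Equiv.Perm X := S.lift S.sig S.sig_mul

theorem perm_of (x : X) : S.perm (S.of x) = S.sig x := S.lift_of _ _ x

/-- A permutation of `X` extended to the free abelian group `ℤ^(X)`. -/
def permMap (s : Equiv.Perm X) : FreeAbelianGroup X →+ FreeAbelianGroup X := FreeAbelianGroup.map s

theorem permMap_of (s : Equiv.Perm X) (x : X) :
    permMap s (FreeAbelianGroup.of x) = FreeAbelianGroup.of (s x) := FreeAbelianGroup.map_of_apply x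

theorem permMap_mul (s t : Equiv.Perm X) (m : FreeAbelianGroup X) :
    permMap (s * t) m = permMap s (permMap t m) :=
  FreeAbelianGroup.map_comp_apply (f := t) (g := s) m

theorem permMap_one (m : FreeAbelianGroup X) : permMap (1 : Equiv.Perm X) m = m :=
  FreeAbelianGroup.map_id_apply m

/-- The affine permutation `m ↦ e_x + σ_x(m)` of `ℤ^(X)`. -/
noncomputable def affOf (x : X) : Equiv.Perm (FreeAbelianGroup X) where
  toFun m := FreeAbelianGroup.of x + permMap (S.sig x) m
  invFun m := permMap (S.sig x)⁻¹ (-FreeAbelianGroup.of x + m)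
  left_inv m := by simp [← permMap_mul, permMap_one]
  right_inv m := by simp [← permMap_mul, permMap_one]

theorem affOf_apply (x : X) (m : FreeAbelianGroup X) :
    S.affOf x m = FreeAbelianGroup.of x + permMap (S.sig x) m := rfl

/-- The action of `G(X, r)` on `ℤ^(X)` by affine maps in which `x` acts as `m ↦ e_x + σ_x(m)`. -/
noncomputable def aff : S.StructureGroup →* Equiv.Perm (FreeAbelianGroup X) :=
  S.lift S.affOf (by
    intro x y
    ext m
    simp only [Equiv.Perm.mul_apply, affOf_apply, map_add, permMap_of, ← permMap_mul,
      ← S.sig_mul x y, sig_sig_tau]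
    abel)

/-- The cocycle `π : G(X, r) → ℤ^(X)`, `π(g) = g · 0`; thus `π(x) = e_x` and
`π(g ∘ h) = π(g) + g · π(h)` with `G(X, r)` permuting the basis `X` through `x ↦ σ_x`. -/
noncomputable def cocycle (g : S.StructureGroup) : FreeAbelianGroup X := S.aff g 0

theorem cocycle_of (x : X) : S.cocycle (S.of x) = FreeAbelianGroup.of x := by
  simp [cocycle, aff, lift_of, affOf_apply]

theorem aff_apply (g : S.StructureGroup) (m : FreeAbelianGroup X) :
    S.aff g m = S.cocycle g + permMap (S.perm g) m := by
  have hof : ∀ x m, S.aff (S.of x) m = FreeAbelianGroup.of x + permMap (S.sig x) m := by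
    intro x m
    rw [aff, lift_of, affOf_apply]
  unfold cocycle
  induction g using structureGroup_induction generalizing m with
  | one => simp [permMap_one]
  | mul_of g x ih =>
    rw [map_mul, map_mul, Equiv.Perm.mul_apply, Equiv.Perm.mul_apply, ih, ih (S.aff (S.of x) 0),
      hof, hof, perm_of, permMap_mul]
    simp only [map_add, map_zero]
    abel
  | mul_inv g x ih =>
    have hinv : ∀ m, S.aff (S.of x)⁻¹ m = S.aff (S.of x)⁻¹ 0 + permMap (S.sig x)⁻¹ m := by
      intro m
      rw [map_inv, Equiv.Perm.inv_eq_iff_eq, hof, map_add, ← permMap_mul, mul_inv_cancel,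
        permMap_one, ← add_assoc, ← hof, ← Equiv.Perm.mul_apply, mul_inv_cancel]
      simp
    rw [map_mul, map_mul, Equiv.Perm.mul_apply, Equiv.Perm.mul_apply, ih,
      ih (S.aff (S.of x)⁻¹ 0), hinv, map_inv S.perm, perm_of, permMap_mul]
    simp only [map_add]
    abel

theorem cocycle_mul (g h : S.StructureGroup) :
    S.cocycle (g * h) = S.cocycle g + permMap (S.perm g) (S.cocycle h) := by
  rw [← aff_apply]
  simp [cocycle]

/-- The permutation `g ↦ g ∘ (g⁻¹ · y)` of `G(X, r)`; it corresponds to adding `e_y` in `ℤ^(X)`. -/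
noncomputable def shift (y : X) : Equiv.Perm S.StructureGroup where
  toFun g := g * S.of ((S.perm g)⁻¹ y)
  invFun g := g * (S.of (S.op.diag ((S.perm g)⁻¹ y)))⁻¹
  left_inv g := by
    have h : S.op.diag ((S.perm (g * S.of ((S.perm g)⁻¹ y)))⁻¹ y) = (S.perm g)⁻¹ y := by
      rw [map_mul, perm_of, mul_inv_rev, Equiv.Perm.mul_apply]
      exact S.op_diag_diag _
    simp only [h, mul_inv_cancel_right]
  right_inv g := by
    have h : (S.perm (g * (S.of (S.op.diag ((S.perm g)⁻¹ y)))⁻¹))⁻¹ y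
        = S.op.diag ((S.perm g)⁻¹ y) := by
      rw [map_mul, map_inv, perm_of, mul_inv_rev, inv_inv, Equiv.Perm.mul_apply]
      conv_lhs => arg 2; rw [← S.diag_op_diag ((S.perm g)⁻¹ y)]
      exact S.sig_diag _
    simp only [h, inv_mul_cancel_right]

theorem shift_apply (y : X) (g : S.StructureGroup) :
    S.shift y g = g * S.of ((S.perm g)⁻¹ y) := rfl

theorem shift_comm (y z : X) : S.shift y * S.shift z = S.shift z * S.shift y := by
  ext g
  have h : ∀ x w : X, S.of x * S.of ((S.sig x)⁻¹ w) = S.of w * S.of ((S.sig w)⁻¹ x) := by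
    intro x w
    rw [of_mul_of]
    have e : S.sig x ((S.sig x)⁻¹ w) = w := by simp
    have e2 : S.tau ((S.sig x)⁻¹ w) x = (S.sig w)⁻¹ x := by
      rw [Equiv.Perm.eq_inv_iff_eq]
      have := S.sig_sig_tau x ((S.sig x)⁻¹ w)
      rwa [e] at this
    rw [e, e2]
  simp only [Equiv.Perm.mul_apply, shift_apply, map_mul, perm_of, mul_inv_rev, mul_assoc]
  rw [h]

theorem cocycle_shift (y : X) (g : S.StructureGroup) :
    S.cocycle (S.shift y g) = S.cocycle g + FreeAbelianGroup.of y := by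
  rw [shift_apply, cocycle_mul, cocycle_of, permMap_of]
  simp

/-- The cocycle is a bijection. -/
theorem cocycle_bijective : Function.Bijective S.cocycle := by
  have hcomm : IsMulCommutative (Subgroup.closure (Set.range S.shift)) :=
    Subgroup.isMulCommutative_closure (by
      rintro _ ⟨y, rfl⟩ _ ⟨z, rfl⟩
      exact S.shift_comm y z)
  let : CommGroup (Subgroup.closure (Set.range S.shift)) :=
    { (inferInstance : Group (Subgroup.closure (Set.range S.shift))) with
      mul_comm := hcomm.is_comm.comm }
  let F : FreeAbelianGroup X →+ Additive (Subgroup.closure (Set.range S.shift)) :=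
    FreeAbelianGroup.lift fun y =>
      Additive.ofMul ⟨S.shift y, Subgroup.subset_closure ⟨y, rfl⟩⟩
  let s : FreeAbelianGroup X → S.StructureGroup := fun m =>
    ((F m).toMul : Equiv.Perm S.StructureGroup) 1
  have s_add : ∀ y m, s (m + FreeAbelianGroup.of y) = S.shift y (s m) := by
    intro y m
    simp only [s]
    rw [add_comm, map_add]
    simp only [F, FreeAbelianGroup.lift_apply_of]
    rfl
  have s_sub : ∀ y m, s (m - FreeAbelianGroup.of y) = (S.shift y)⁻¹ (s m) := by
    intro y m
    rw [Equiv.Perm.eq_inv_iff_eq, ← s_add, sub_add_cancel]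
  have s_zero : s 0 = 1 := by simp [s]
  have c_one : S.cocycle 1 = 0 := by simp [cocycle]
  have hs : ∀ g, s (S.cocycle g) = g := by
    intro g
    induction g using structureGroup_induction with
    | one => rw [c_one, s_zero]
    | mul_of g x ih =>
      rw [cocycle_mul, cocycle_of, permMap_of, s_add, ih, shift_apply]
      simp
    | mul_inv g x ih =>
      have e : S.shift (S.perm (g * (S.of x)⁻¹) x) (g * (S.of x)⁻¹) = g := by
        rw [shift_apply]
        simp
      have e2 := S.cocycle_shift (S.perm (g * (S.of x)⁻¹) x) (g * (S.of x)⁻¹)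
      rw [e] at e2
      rw [← sub_eq_iff_eq_add] at e2
      rw [← e2, s_sub, ih, Equiv.Perm.inv_eq_iff_eq, e]
  refine ⟨Function.LeftInverse.injective hs, fun m => ⟨s m, ?_⟩⟩
  have key : ∀ a : FreeAbelianGroup X, ∀ m, S.cocycle (s (m + a)) = S.cocycle (s m) + a := by
    intro a
    induction a using FreeAbelianGroup.induction_on with
    | zero => simp
    | of x => intro m; rw [s_add, cocycle_shift]
    | neg x _ =>
      intro m
      have h := S.cocycle_shift x ((S.shift x)⁻¹ (s m))
      rw [← Equiv.Perm.mul_apply, mul_inv_cancel, Equiv.Perm.one_apply] at h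
      rw [← sub_eq_add_neg, s_sub, h, add_neg_cancel_right]
    | add a b ha hb => intro m; rw [← add_assoc, hb, ha, add_assoc]
  have := key m 0
  rwa [zero_add, s_zero, c_one, zero_add] at this

/-- The cocycle as an equivalence `G(X, r) ≃ ℤ^(X)`. -/
noncomputable def cocycleEquiv : S.StructureGroup ≃ FreeAbelianGroup X :=
  Equiv.ofBijective S.cocycle S.cocycle_bijective

/-- The additive group of `G(X, r)`: the structure of `ℤ^(X)` transported along the cocycle. -/
noncomputable instance : AddCommGroup S.StructureGroup := S.cocycleEquiv.addCommGroup

theorem cocycle_add (g h : S.StructureGroup) : S.cocycle (g + h) = S.cocycle g + S.cocycle h :=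
  S.cocycleEquiv.apply_symm_apply _

/-- The left brace `G(X, r)`. -/
noncomputable instance : LeftBrace S.StructureGroup where
  mul_add_brace := by
    intro a b c
    apply S.cocycle_bijective.injective
    have hsub : ∀ g h, S.cocycle (g - h) = S.cocycle g - S.cocycle h := by
      intro g h
      rw [eq_sub_iff_add_eq, ← cocycle_add, sub_add_cancel]
    rw [cocycle_add, hsub, cocycle_mul, cocycle_mul, cocycle_mul, cocycle_add, map_add]
    abel

/-- On generators the `λ`-action of the left brace `G(X, r)` is given by `σ`, that is,
`x ∘ y = x + σ_x(y)`. -/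
theorem of_mul_of_eq_add (x y : X) : S.of x * S.of y = S.of x + S.of (S.sig x y) := by
  apply S.cocycle_bijective.injective
  rw [cocycle_add, cocycle_mul, cocycle_of, cocycle_of, cocycle_of, perm_of, permMap_of]

/-- The permutation brace `𝒢(X, r) = G(X, r) / Soc(G(X, r))`. -/
abbrev PermutationBrace : Type u :=
  LeftBrace.QuotientBrace (LeftBrace.socle S.StructureGroup) LeftBrace.socle_isIdeal

end Solution

end YB

/-! Let `A = B + C` be the permutation brace. For `b` in `B` and `c` in `C` one has `c ∘ b = λ_c(b)
∘ c'` with `c'` in `C`. Evaluate `λ` of both sides on `C`, which is stable under `λ` and on which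
`λ_c` and `λ_c'` are the identity: the result is that `λ_b` and `λ_{λ_c(b)}` agree on `C`. On `B`
both are the identity, so they agree on `A = B + C`, and `λ_c(b) - b` lies in `Soc(A)`. Additivity
and the symmetry between `B` and `C` extend this to `λ_a(d) - d ∈ Soc(A)` for all `a`, `d`
(`IsFactorization.lam_sub_mem_socle`).

For `x`, `y` in `X` this says that the images of `σ_x(y)` and `y` in `A` have the same `λ`. Equality
of images in `A` forces equality of `σ` (`sig_eq_of_toPermutationBrace_eq`), so `σ_x(y)` and `y`
have the same class in the second retraction. There every `σ` is the identity, and one more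
retraction leaves a point. -/

/-! ### Factorizations of left braces through trivial left ideals -/

namespace LeftBrace

variable {A : Type u} [LeftBrace A]

theorem lam_inv_lam (a b : A) : lam a⁻¹ (lam a b) = b := by
  rw [← lam_mul, inv_mul_cancel, lam_one]

/-- Elements acting in the same way through `λ` differ by an element of the socle. -/
theorem sub_mem_socle_of_lam_eq {a b : A} (h : ∀ d, lam a d = lam b d) : b - a ∈ socle A := by
  -- For an ideal, the additive difference may be replaced by `a⁻¹ * b`, whose `λ` is `λ_a⁻¹ λ_b`.
  rw [sub_eq_neg_add, socle_isIdeal.sub_mem_iff]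
  intro d
  rw [lam_mul, ← h, lam_inv_lam]

/-- Adding a socle element `s` on the left is the same as multiplying by it, since `s ∘ a = s +
λ_s(a) = s + a`; and `λ_s` is the identity. -/
theorem lam_eq_of_sub_mem_socle {a b : A} (h : b - a ∈ socle A) (d : A) : lam b d = lam a d := by
  have e : b = (b - a) * a := by rw [mul_eq, h]; abel
  rw [e, lam_mul, h]

theorem IsTrivialOn.lam_eq {I : AddSubgroup A} (hI : IsTrivialOn I) {a b : A} (ha : a ∈ I)
    (hb : b ∈ I) : lam a b = b := by
  rw [lam, ← hI a ha b hb, neg_add_cancel_left]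

theorem IsFactorization.symm {B C : AddSubgroup A} (h : IsFactorization B C) :
    IsFactorization C B where
  left_isLeftIdeal := h.right_isLeftIdeal
  right_isLeftIdeal := h.left_isLeftIdeal
  exists_add a := by
    obtain ⟨b, hb, c, hc, e⟩ := h.exists_add a
    exact ⟨c, hc, b, hb, e.trans (add_comm b c)⟩

/-- In a factorization through trivial left ideals each factor acts trivially on the other one
modulo the socle. -/
theorem IsFactorization.lam_sub_mem_socle_of_mem {B C : AddSubgroup A} (h : IsFactorization B C)
    (hB : IsTrivialOn B) (hC : IsTrivialOn C) {b c : A} (hb : b ∈ B) (hc : c ∈ C) :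
    lam c b - b ∈ socle A := by
  have hb' : lam c b ∈ B := h.left_isLeftIdeal c b hb
  have hc' : lam (lam c b)⁻¹ c ∈ C := h.right_isLeftIdeal _ c hc
  -- Both products equal `c + λ_c(b)`; this is the braiding of `c` and `b`, with its second
  -- component again in `C`.
  have e : c * b = lam c b * lam (lam c b)⁻¹ c := by
    rw [mul_eq c, mul_eq (lam c b), ← lam_mul (lam c b), mul_inv_cancel, lam_one, add_comm]
  have key : ∀ d ∈ C, lam b d = lam (lam c b) d := by
    intro d hd
    have h1 := congrArg (fun g => lam g d) e
    simp only [lam_mul] at h1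
    rwa [hC.lam_eq hc (h.right_isLeftIdeal b d hd), hC.lam_eq hc' hd] at h1
  apply sub_mem_socle_of_lam_eq
  intro d
  obtain ⟨d₁, h₁, d₂, h₂, rfl⟩ := h.exists_add d
  -- On the `B`-component both maps are the identity; on the `C`-component they agree by `key`.
  rw [lam_add, lam_add, hB.lam_eq hb h₁, hB.lam_eq hb' h₁, key d₂ h₂]

/-- A left brace that factorizes through two trivial left ideals is trivial modulo its socle. -/
theorem IsFactorization.lam_sub_mem_socle {B C : AddSubgroup A} (h : IsFactorization B C)
    (hB : IsTrivialOn B) (hC : IsTrivialOn C) (a d : A) : lam a d - d ∈ socle A := by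
  -- Quantified over the pair of ideals so that it also applies with the two exchanged.
  have of_mem : ∀ {B C : AddSubgroup A}, IsFactorization B C → IsTrivialOn B → IsTrivialOn C →
      ∀ c ∈ C, ∀ d, lam c d - d ∈ socle A := by
    intro B C h hB hC c hc d
    obtain ⟨d₁, h₁, d₂, h₂, rfl⟩ := h.exists_add d
    rw [lam_add, hC.lam_eq hc h₂, add_sub_add_right_eq_sub]
    exact h.lam_sub_mem_socle_of_mem hB hC h₁ hc
  obtain ⟨b, hb, c, hc, rfl⟩ := h.exists_add a
  have e : b + c = b * lam b⁻¹ c := by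
    rw [mul_eq, ← lam_mul, mul_inv_cancel, lam_one]
  -- With `w = λ_{c'}(d)` and `c' = λ_b⁻¹(c)` in `C`, split `λ_b(w) - d = (λ_b(w) - w) + (w - d)`.
  rw [e, lam_mul, ← sub_add_sub_cancel _ (lam (lam b⁻¹ c) d)]
  exact (socle A).add_mem (of_mem h.symm hC hB b hb _)
    (of_mem h hB hC _ (h.right_isLeftIdeal _ c hc) d)

theorem QuotientBrace.mk_lam {I : AddSubgroup A} (hI : IsIdeal I) (a b : A) :
    QuotientBrace.mk hI (lam a b) = lam (QuotientBrace.mk hI a) (QuotientBrace.mk hI b) := rfl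

end LeftBrace

/-! ### From the permutation brace to iterated retractions -/

namespace YB.Solution

open LeftBrace

variable {X : Type u} (S : Solution X)

theorem lam_of_of (x y : X) : lam (S.of x) (S.of y) = S.of (S.sig x y) := by
  rw [lam, of_mul_of_eq_add, neg_add_cancel_left]

/-- The cocycle sends generators to the basis of the free abelian group on `X`. -/
theorem of_injective : Function.Injective S.of := by
  intro x y h
  have := congrArg S.cocycle h
  rw [cocycle_of, cocycle_of] at this
  exact FreeAbelianGroup.of_injective this

/-- The canonical map `X → 𝒢(X, r)`. -/
noncomputable def toPermutationBrace (x : X) : S.PermutationBrace :=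
  QuotientBrace.mk socle_isIdeal (S.of x)

theorem lam_toPermutationBrace (x y : X) :
    lam (S.toPermutationBrace x) (S.toPermutationBrace y) = S.toPermutationBrace (S.sig x y) := by
  rw [toPermutationBrace, toPermutationBrace, ← QuotientBrace.mk_lam, lam_of_of,
    toPermutationBrace]

/-- Elements of `G(X, r)` that agree modulo the socle have the same `λ`, and on the embedded copy of
`X` the maps `λ` of generators are the `σ`. -/
theorem sig_eq_of_toPermutationBrace_eq {x y : X}
    (h : S.toPermutationBrace x = S.toPermutationBrace y) : S.sig x = S.sig y := by
  have h1 : -S.of x + S.of y ∈ socle S.StructureGroup :=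
    (socle_isIdeal.sub_mem_iff _ _).2 ((QuotientBrace.mk_eq _).1 h)
  rw [← sub_eq_neg_add] at h1
  ext z
  apply S.of_injective
  rw [← lam_of_of, ← lam_of_of, lam_eq_of_sub_mem_socle h1]

theorem ret_sig_toRet (x y : X) : S.ret.sig (S.toRet x) (S.toRet y) = S.toRet (S.sig x y) := rfl

/-- If the permutation brace is trivial modulo its socle, the third retraction is a point. -/
theorem subsingleton_iterRet_three
    (h : ∀ a b : S.PermutationBrace, lam a b - b ∈ socle S.PermutationBrace) :
    Subsingleton (S.iterRet 3).1 := by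
  -- In the permutation brace, `λ_x(y)` and `y` differ by a socle element, so they act alike on the
  -- image of `z`.
  have key : ∀ x y z, S.sig (S.sig (S.sig x y) z) = S.sig (S.sig y z) := by
    intro x y z
    apply sig_eq_of_toPermutationBrace_eq
    simp only [← lam_toPermutationBrace]
    exact lam_eq_of_sub_mem_socle (h _ _) _
  have key2 : ∀ x y, S.ret.sig (S.toRet (S.sig x y)) = S.ret.sig (S.toRet y) := by
    intro x y
    ext c
    obtain ⟨z, rfl⟩ := S.toRet_surjective c
    rw [ret_sig_toRet, ret_sig_toRet, toRet_eq]
    exact key x y z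
  -- By `key2`, the class of `σ_x(y)` in the second retraction is that of `y`.
  have key3 : ∀ a b, S.ret.ret.sig a b = b := by
    intro a b
    obtain ⟨a, rfl⟩ := S.ret.toRet_surjective a
    obtain ⟨b, rfl⟩ := S.ret.toRet_surjective b
    obtain ⟨x, rfl⟩ := S.toRet_surjective a
    obtain ⟨y, rfl⟩ := S.toRet_surjective b
    rw [ret_sig_toRet, ret_sig_toRet, toRet_eq]
    exact key2 x y
  constructor
  intro a b
  obtain ⟨a, rfl⟩ := S.ret.ret.toRet_surjective a
  obtain ⟨b, rfl⟩ := S.ret.ret.toRet_surjective b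
  refine S.ret.ret.toRet_eq.2 (Equiv.ext fun c => ?_)
  rw [key3, key3]

theorem nonempty_iterRet [Nonempty X] (n : ℕ) : Nonempty (S.iterRet n).1 := by
  induction n with
  | zero => assumption
  | succ n ih => exact ih.map (S.iterRet n).2.toRet

/-- If some iterated retraction is a point, the first such one gives the multipermutation level. -/
theorem exists_isMultipermutation_le [Nonempty X] {n : ℕ} (h : Subsingleton (S.iterRet n).1) :
    ∃ m ≤ n, S.IsMultipermutation m := by
  classical
  have hn : Nat.card (S.iterRet n).1 = 1 :=
    Nat.card_eq_one_iff_unique.2 ⟨h, S.nonempty_iterRet n⟩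
  have hex : ∃ m, Nat.card (S.iterRet m).1 = 1 := ⟨n, hn⟩
  refine ⟨Nat.find hex, Nat.find_min' hex hn, Nat.find_spec hex, fun k hk => ?_⟩
  -- Minimality at `k = m - 1`; as the set is nonempty, not being a singleton means having at least
  -- two elements, also when it is infinite and `Nat.card` is `0`.
  have hk' : Nat.card (S.iterRet k).1 ≠ 1 := Nat.find_min hex (by omega)
  by_contra hnt
  exact hk' (Nat.card_eq_one_iff_unique.2
    ⟨not_nontrivial_iff_subsingleton.1 hnt, S.nonempty_iterRet k⟩)

end YB.Solution

theorem corollary2p13 {X : Type u} [Nontrivial X] (S : YB.Solution X)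
    (h : ∃ B C : AddSubgroup S.PermutationBrace,
      LeftBrace.IsFactorization B C ∧ LeftBrace.IsTrivialOn B ∧ LeftBrace.IsTrivialOn C) :
    ∃ m ≤ 3, S.IsMultipermutation m := by
  obtain ⟨B, C, hBC, hB, hC⟩ := h
  exact S.exists_isMultipermutation_le
    (S.subsingleton_iterRet_three (hBC.lam_sub_mem_socle hB hC))
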